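/- For nonnegative integers $n$ and positive integers $r$ let $H_n^{(r)}=\sum_{j=1}^n \frac1{j^r}$ (so $H_0^{(r)}=0$), and write $H_n=H_n^{(1)}$. For $k\ge 0$ define the polynomials \[ P_k(y_1,\dots,y_k)=\sum_{m_1+2m_2+\cdots+km_k=k}\frac{(-1)^{m_2+m_4+\cdots}}{m_1!\,m_2!\cdots m_k!}\left(\frac{y_1}{1}\right)^{m_1}\left(\frac{y_2}{2}\right)^{m_2}\cdots\left(\frac{y_k}{k}\right)^{m_k}, \] \[ Q_k(y_1,\dots,y_k)=\sum_{m_1+2m_2+\cdots+km_k=k}\frac{1}{m_1!\,m_2!\cdots m_k!}\left(\frac{y_1}{1}\right)^{m_1}\left(\frac{y_2}{2}\right)^{m_2}\cdots\left(\frac{y_k}{k}\right)^{m_k}, \] the sums being over nonnegative integers $m_1,\dots,m_k$ (so $P_0=Q_0=1$); equivalently, $P_k(p_1,\dots,p_k)=e_k$ and $Q_k(p_1,\dots,p_k)=h_k$, where $p_i$, $e_i$, $h_i$ are the power-sum, elementary and complete homogeneous symmetric functions. Then for all nonnegative integers $k,l$ the following series converges and \[ \sum_{n=0}^\infty\frac{Q_l\bigl(H_{n+1},H_{n+1}^{(2)},\dots,H_{n+1}^{(l)}\bigr)\,P_k\bigl(H_n,H_n^{(2)},\dots,H_n^{(k)}\bigr)}{(n+1)^2}=\binom{l+k+1}{l}\,\zeta(l+k+2),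 \] where $\zeta$ is the Riemann zeta function. -/

import Mathlib

namespace HarmonicSums

/-- The generalized harmonic number `H_n^{(r)} = ∑_{j=1}^n 1 / j^r`; in particular
`H_0^{(r)} = 0`. -/
noncomputable def genHarmonic (n r : ℕ) : ℝ :=
  ∑ j ∈ Finset.Icc 1 n, 1 / (j : ℝ) ^ r

/-- The weight `1 / (m_1! m_2! ⋯) * (y_1 / 1)^{m_1} (y_2 / 2)^{m_2} ⋯` of the partition of `n`
having `m_j` parts equal to `j`, as a polynomial in `y_1, …, y_n`. The variable `y_j` is
`MvPolynomial.X i` for the index `i : Fin n` with `i + 1 = j`. -/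
noncomputable def partitionWeight {n : ℕ} (μ : n.Partition) : MvPolynomial (Fin n) ℚ :=
  ∏ i : Fin n,
    MvPolynomial.C (1 / ((μ.parts.count (i.val + 1)).factorial : ℚ)) *
      (MvPolynomial.C (1 / ((i.val : ℚ) + 1)) * MvPolynomial.X i) ^ μ.parts.count (i.val + 1)

/-- The polynomial `P_n(y_1, …, y_n)` expressing the elementary symmetric function `e_n` in the
power sums: the sum over all partitions of `n` of the partition weight with the
sign `(-1)^{m_2 + m_4 + ⋯}`, the exponent being the number of even parts. -/
noncomputable def P (n : ℕ) : MvPolynomial (Fin n) ℚ :=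
  ∑ μ : n.Partition, (-1) ^ (μ.parts.filter (fun j => Even j)).card * partitionWeight μ

/-- The polynomial `Q_n(y_1, …, y_n)` expressing the complete symmetric function `h_n` in the
power sums: the sum over all partitions of `n` of the partition weight. -/
noncomputable def Q (n : ℕ) : MvPolynomial (Fin n) ℚ :=
  ∑ μ : n.Partition, partitionWeight μ

/-- The value `F(H_n, H_n^{(2)}, …, H_n^{(k)})` of a polynomial `F` in `k` variables. -/
noncomputable def evalHarmonic {k : ℕ} (F : MvPolynomial (Fin k) ℚ) (n : ℕ) : ℝ :=
  MvPolynomial.aeval (fun i : Fin k => genHarmonic n (i.val + 1)) F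

end HarmonicSums

/-! The identity is a comparison of coefficients in two variables. At `1, 1/2, …, 1/n` the series `∑
h_l x^l` is `∏ (1 - x/j)⁻¹` and `∑ e_k y^k` is `∏ (1 + y/j)`, so multiplying the left sides by `x^l
y^k` and summing over `l, k` gives `S(1 - x)`, where `S(b) = ∑_n (1+y)_n / ((b)_{n+1} (n+1))`.

The difference `S(b) - S(b+1)` telescopes to `1 / (b (b - y))` and `S(b + M) → 0`, hence `S(b) = ∑_m
1 / ((b+m)(b+m-y))` (`hasSum_risingQuot`). At `b = 1 - x` the geometric and negative binomial series
expand each term into `∑ C(l+k+1, l) x^l y^k / (m+1)^(l+k+2)`, and summing over `m` produces the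
zeta values.

All coefficients are nonnegative, so sums may be interchanged freely for small positive `x, y`;
uniqueness of double power series (`eq_of_hasSum_pow_mul_pow`) finishes. The partition polynomials
are identified with `h_l` and `e_k` through Newton's recurrence, which is the logarithmic derivative
of the generating function. -/

open Finset Filter Topology

/-! ### Partition sums and Newton's recurrence -/

namespace HarmonicSums

/-- The factor contributed by `c` parts equal to `i`. -/
noncomputable def partFactor (y : ℕ → ℝ) (i c : ℕ) : ℝ :=
  1 / (c.factorial : ℝ) * (1 / (i : ℝ) * y i) ^ c

/-- The weight of a multiset of parts. -/
noncomputable def multisetWeight (y : ℕ → ℝ) (s : Multiset ℕ) : ℝ :=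
  ∏ i ∈ s.toFinset, partFactor y i (s.count i)

/-- The sum over all partitions of `n` of their weights. -/
noncomputable def partitionSum (y : ℕ → ℝ) (n : ℕ) : ℝ :=
  ∑ μ : n.Partition, multisetWeight y μ.parts

theorem multisetWeight_eq_prod (y : ℕ → ℝ) {s : Multiset ℕ} {S : Finset ℕ}
    (h : s.toFinset ⊆ S) : multisetWeight y s = ∏ i ∈ S, partFactor y i (s.count i) := by
  refine Finset.prod_subset h fun i _ hi => ?_
  have : s.count i = 0 := by simpa using hi
  simp [partFactor, this]

/-- The new multiplicity cancels one factor of the factorial, and `i` cancels the denominator under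
`y i`. -/
theorem multisetWeight_cons (y : ℕ → ℝ) (s : Multiset ℕ) {i : ℕ} (hi : i ≠ 0) :
    ((i ::ₘ s).count i : ℝ) * i * multisetWeight y (i ::ₘ s) = y i * multisetWeight y s := by
  have hi' : (i : ℝ) ≠ 0 := by exact_mod_cast hi
  have hmem : i ∈ insert i s.toFinset := Finset.mem_insert_self _ _
  rw [multisetWeight_eq_prod y (s := i ::ₘ s) (S := insert i s.toFinset) (by simp),
    multisetWeight_eq_prod y (s := s) (S := insert i s.toFinset) (Finset.subset_insert _ _),
    ← Finset.mul_prod_erase _ _ hmem, ← Finset.mul_prod_erase _ _ hmem]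
  have hrest : ∏ j ∈ (insert i s.toFinset).erase i, partFactor y j ((i ::ₘ s).count j) =
      ∏ j ∈ (insert i s.toFinset).erase i, partFactor y j (s.count j) := by
    refine Finset.prod_congr rfl fun j hj => ?_
    rw [Multiset.count_cons_of_ne (Finset.ne_of_mem_erase hj)]
  rw [hrest, Multiset.count_cons_self]
  have hfac : ((s.count i).factorial : ℝ) ≠ 0 := by positivity
  have hc : ((s.count i : ℝ) + 1) ≠ 0 := by positivity
  simp only [partFactor, Nat.factorial_succ, pow_succ]
  push_cast
  field_simp

theorem partitionSum_zero (y : ℕ → ℝ) : partitionSum y 0 = 1 := by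
  simp [partitionSum, multisetWeight]

theorem sum_count_mul_eq {n : ℕ} (μ : n.Partition) :
    ∑ i ∈ Finset.range n, ((μ.parts.count (i + 1) : ℝ) * ((i + 1 : ℕ) : ℝ)) = n := by
  have h1 : ∑ i ∈ Finset.Icc 1 n, μ.parts.count i * i = n := by
    conv_rhs => rw [← μ.parts_sum, Finset.sum_multiset_count]
    simp only [smul_eq_mul]
    refine (Finset.sum_subset (fun i hi => ?_) fun i _ hi => ?_).symm
    · rw [Multiset.mem_toFinset] at hi
      exact Finset.mem_Icc.2 ⟨μ.parts_pos hi, μ.le_of_mem_parts hi⟩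
    · rw [Multiset.mem_toFinset] at hi
      simp [hi]
  have h2 : ∑ i ∈ Finset.range n, μ.parts.count (i + 1) * (i + 1) = n := by
    conv_rhs => rw [← h1]
    rw [Finset.range_eq_Ico, Finset.sum_Ico_add' (fun i => μ.parts.count i * i) 0 n 1]
    rfl
  exact_mod_cast h2

/-- Removing one part `i` is a bijection from the partitions of `n` containing `i` to those of `n -
i`; the other partitions contribute zero. -/
theorem sum_count_mul_weight (y : ℕ → ℝ) (n : ℕ) {i : ℕ} (hi0 : i ≠ 0) (hi : i ≤ n) :
    ∑ μ : n.Partition, (μ.parts.count i : ℝ) * i * multisetWeight y μ.parts =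
      y i * partitionSum y (n - i) := by
  classical
  have h1 : ∑ μ : n.Partition, (μ.parts.count i : ℝ) * i * multisetWeight y μ.parts =
      ∑ μ : n.Partition with i ∈ μ.parts,
        (μ.parts.count i : ℝ) * i * multisetWeight y μ.parts := by
    refine (Finset.sum_subset (Finset.filter_subset _ _) fun μ _ hμ => ?_).symm
    have : i ∉ μ.parts := by simpa using hμ
    simp [this]
  rw [h1, partitionSum, Finset.mul_sum]
  refine Finset.sum_bij'
    (fun μ hμ => ⟨μ.parts.erase i, fun h => μ.parts_pos (Multiset.mem_of_mem_erase h), ?_⟩)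
    (fun ν _ => ⟨i ::ₘ ν.parts, fun {j} h => ?_, ?_⟩) ?_ ?_ ?_ ?_ ?_
  · have hm : i ∈ μ.parts := by simpa using hμ
    have := Multiset.sum_erase hm
    rw [μ.parts_sum] at this
    omega
  · rcases Multiset.mem_cons.1 h with rfl | h
    · omega
    · exact ν.parts_pos h
  · rw [Multiset.sum_cons, ν.parts_sum]; omega
  · intro μ _; exact Finset.mem_univ _
  · intro ν _; simp
  · intro μ hμ
    have hm : i ∈ μ.parts := by simpa using hμ
    ext1
    exact Multiset.cons_erase hm
  · intro ν _
    ext1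
    exact Multiset.erase_cons_head _ _
  · intro μ hμ
    have hm : i ∈ μ.parts := by simpa using hμ
    have := multisetWeight_cons y (μ.parts.erase i) hi0
    rwa [Multiset.cons_erase hm] at this

/-- The Newton-type recurrence for the partition sums. -/
theorem succ_mul_partitionSum (y : ℕ → ℝ) (n : ℕ) :
    ((n : ℝ) + 1) * partitionSum y (n + 1) =
      ∑ i ∈ Finset.range (n + 1), y (i + 1) * partitionSum y (n - i) := by
  have : ∀ i ∈ Finset.range (n + 1), y (i + 1) * partitionSum y (n - i) =
      ∑ μ : (n + 1).Partition,
        (μ.parts.count (i + 1) : ℝ) * ((i + 1 : ℕ) : ℝ) * multisetWeight y μ.parts := by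
    intro i hi
    have hi' := Finset.mem_range.1 hi
    rw [sum_count_mul_weight y (n + 1) (Nat.succ_ne_zero i) (by omega), Nat.succ_sub_succ]
  -- After the exchange each partition carries the factor `∑ i * m_i`, which is its size `n + 1`.
  rw [Finset.sum_congr rfl this, Finset.sum_comm, partitionSum, Finset.mul_sum]
  refine Finset.sum_congr rfl fun μ _ => ?_
  rw [← Finset.sum_mul, sum_count_mul_eq]
  push_cast
  rfl

open PowerSeries in
/-- A power series with constant term `1` and logarithmic derivative `∑ y (i + 1) X ^ i` is the
generating function of the partition sums of `y`. -/
theorem coeff_eq_partitionSum (y : ℕ → ℝ) (A : PowerSeries ℝ) (h0 : coeff 0 A = 1)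
    (hd : PowerSeries.derivative ℝ A = PowerSeries.mk (fun i => y (i + 1)) * A) (n : ℕ) :
    coeff n A = partitionSum y n := by
  induction n using Nat.strong_induction_on with
  | _ n ih =>
    cases n with
    | zero => rw [h0, partitionSum_zero]
    | succ n =>
      have hn : ((n : ℝ) + 1) ≠ 0 := by positivity
      apply mul_left_cancel₀ hn
      rw [succ_mul_partitionSum]
      have := congrArg (coeff n) hd
      rw [PowerSeries.coeff_derivative, PowerSeries.coeff_mul,
        Finset.Nat.sum_antidiagonal_eq_sum_range_succ_mk] at this
      rw [mul_comm, this]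
      refine Finset.sum_congr rfl fun i hi => ?_
      rw [PowerSeries.coeff_mk, ih (n - i) (by omega)]

/-! ### Generating functions of `h_l` and `e_k` at reciprocals of integers -/

/-- The generating function of the complete symmetric functions of `1, 1 / 2, …, 1 / n`. -/
noncomputable def completeSeries (n : ℕ) : PowerSeries ℝ :=
  ∏ j ∈ Finset.range n, PowerSeries.mk fun i => (1 / ((j : ℝ) + 1)) ^ i

/-- The generating function of the elementary symmetric functions of `1, 1 / 2, …, 1 / n`. -/
noncomputable def elementarySeries (n : ℕ) : PowerSeries ℝ :=
  ∏ j ∈ Finset.range n, (1 + PowerSeries.C (1 / ((j : ℝ) + 1)) * PowerSeries.X)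

theorem genHarmonic_succ (n r : ℕ) :
    genHarmonic (n + 1) r = genHarmonic n r + (1 / ((n : ℝ) + 1)) ^ r := by
  rw [genHarmonic, genHarmonic, Finset.sum_Icc_succ_top (by omega), one_div_pow]
  push_cast
  rfl

theorem derivative_geometric (t : ℝ) :
    PowerSeries.derivative ℝ (PowerSeries.mk fun i => t ^ i) =
      PowerSeries.mk (fun i => t ^ (i + 1)) * PowerSeries.mk fun i => t ^ i := by
  ext n
  rw [PowerSeries.coeff_derivative, PowerSeries.coeff_mul,
    Finset.sum_congr rfl (g := fun _ => t ^ (n + 1))]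
  · simp [mul_comm]
  · intro p hp
    have := Finset.HasAntidiagonal.mem_antidiagonal.1 hp
    simp only [PowerSeries.coeff_mk, ← pow_add]
    congr 1
    omega

theorem derivative_linear (t : ℝ) :
    PowerSeries.derivative ℝ (1 + PowerSeries.C t * PowerSeries.X) =
      PowerSeries.mk (fun i => (-1) ^ i * t ^ (i + 1)) *
        (1 + PowerSeries.C t * PowerSeries.X) := by
  ext n
  rw [PowerSeries.coeff_derivative, mul_add (PowerSeries.mk _), mul_one, ← mul_assoc, map_add, map_add]
  cases n with
  | zero => simp
  | succ n =>
    rw [PowerSeries.coeff_succ_mul_X, PowerSeries.coeff_succ_mul_X, PowerSeries.coeff_mul_C]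
    simp [PowerSeries.coeff_one]
    ring

theorem coeff_zero_completeSeries (n : ℕ) : PowerSeries.coeff 0 (completeSeries n) = 1 := by
  simp [completeSeries, map_prod, ← PowerSeries.coeff_zero_eq_constantCoeff_apply]

theorem coeff_zero_elementarySeries (n : ℕ) : PowerSeries.coeff 0 (elementarySeries n) = 1 := by
  simp [elementarySeries, map_prod]

theorem derivative_completeSeries (n : ℕ) :
    PowerSeries.derivative ℝ (completeSeries n) =
      PowerSeries.mk (fun i => genHarmonic n (i + 1)) * completeSeries n := by
  induction n with
  | zero =>
    have : (PowerSeries.mk fun i => genHarmonic 0 (i + 1)) = 0 := by ext; simp [genHarmonic]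
    rw [this]
    simp [completeSeries]
  | succ n ih =>
    have hY : (PowerSeries.mk fun i => genHarmonic (n + 1) (i + 1)) =
        (PowerSeries.mk fun i => genHarmonic n (i + 1)) +
          PowerSeries.mk fun i => (1 / ((n : ℝ) + 1)) ^ (i + 1) := by
      ext; simp only [PowerSeries.coeff_mk, map_add, genHarmonic_succ]
    rw [completeSeries, Finset.prod_range_succ, ← completeSeries, Derivation.leibniz, ih,
      derivative_geometric, hY, smul_eq_mul, smul_eq_mul]
    ring

theorem derivative_elementarySeries (n : ℕ) :
    PowerSeries.derivative ℝ (elementarySeries n) =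
      PowerSeries.mk (fun i => (-1) ^ i * genHarmonic n (i + 1)) * elementarySeries n := by
  induction n with
  | zero =>
    have : (PowerSeries.mk fun i => (-1 : ℝ) ^ i * genHarmonic 0 (i + 1)) = 0 := by
      ext; simp [genHarmonic]
    rw [this]
    simp [elementarySeries]
  | succ n ih =>
    have hY : (PowerSeries.mk fun i => (-1 : ℝ) ^ i * genHarmonic (n + 1) (i + 1)) =
        (PowerSeries.mk fun i => (-1) ^ i * genHarmonic n (i + 1)) +
          PowerSeries.mk fun i => (-1) ^ i * (1 / ((n : ℝ) + 1)) ^ (i + 1) := by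
      ext; simp only [PowerSeries.coeff_mk, map_add, genHarmonic_succ, mul_add]
    rw [elementarySeries, Finset.prod_range_succ, ← elementarySeries, Derivation.leibniz, ih,
      derivative_linear, hY, smul_eq_mul, smul_eq_mul]
    ring

theorem multisetWeight_parts (y : ℕ → ℝ) {k : ℕ} (μ : k.Partition) :
    multisetWeight y μ.parts =
      ∏ i : Fin k, partFactor y (i.val + 1) (μ.parts.count (i.val + 1)) := by
  rw [multisetWeight_eq_prod y (S := Finset.Icc 1 k),
    Fin.prod_univ_eq_prod_range (fun i => partFactor y (i + 1) (μ.parts.count (i + 1))) k,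
    Finset.range_eq_Ico,
    Finset.prod_Ico_add' (fun i => partFactor y i (μ.parts.count i)) 0 k 1]
  · rfl
  · intro i hi
    rw [Multiset.mem_toFinset] at hi
    exact Finset.mem_Icc.2 ⟨μ.parts_pos hi, μ.le_of_mem_parts hi⟩

theorem evalHarmonic_partitionWeight {k : ℕ} (μ : k.Partition) (n : ℕ) :
    evalHarmonic (partitionWeight μ) n = multisetWeight (genHarmonic n) μ.parts := by
  rw [multisetWeight_parts, evalHarmonic, partitionWeight, map_prod]
  refine Finset.prod_congr rfl fun i _ => ?_
  simp [partFactor]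

/-- The elementary case is the complete one with `y_i` replaced by `(-1)^(i-1) y_i`, so only even
parts change sign. As `i - 1` is truncated, `i = 0` must be excluded. -/
theorem partFactor_sign (y : ℕ → ℝ) {i : ℕ} (hi : i ≠ 0) (c : ℕ) :
    partFactor (fun i => (-1) ^ (i - 1) * y i) i c =
      (if Even i then (-1) ^ c else 1) * partFactor y i c := by
  obtain ⟨j, rfl⟩ := Nat.exists_eq_succ_of_ne_zero hi
  rcases Nat.even_or_odd j with hj | hj
  · have : ¬ Even j.succ := by rw [Nat.even_add_one]; simpa using hj
    simp [partFactor, this, hj.neg_one_pow]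
  · have h1 : Even j.succ := by rw [Nat.even_add_one]; simpa using hj
    simp only [partFactor, h1, if_true, Nat.succ_sub_one, hj.neg_one_pow]
    rw [show 1 / ((j.succ : ℕ) : ℝ) * (-1 * y j.succ) = -1 * (1 / ((j.succ : ℕ) : ℝ) * y j.succ)
      by ring, mul_pow]
    ring

theorem multisetWeight_sign (y : ℕ → ℝ) {s : Multiset ℕ} (hs : ∀ i ∈ s, i ≠ 0) :
    multisetWeight (fun i => (-1) ^ (i - 1) * y i) s =
      (-1) ^ (s.filter (fun j => Even j)).card * multisetWeight y s := by
  rw [multisetWeight, multisetWeight]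
  rw [Finset.prod_congr rfl fun i hi =>
    partFactor_sign y (hs i (Multiset.mem_toFinset.1 hi)) (s.count i), Finset.prod_mul_distrib]
  congr 1
  have hcard : (s.filter (fun j => Even j)).card =
      ∑ i ∈ s.toFinset, if Even i then s.count i else 0 := by
    rw [← Multiset.toFinset_sum_count_eq, Multiset.toFinset_filter, Finset.sum_filter]
    refine Finset.sum_congr rfl fun i _ => ?_
    split_ifs with h
    · rw [Multiset.count_filter_of_pos h]
    · rfl
  rw [hcard, ← Finset.prod_pow_eq_pow_sum]
  refine Finset.prod_congr rfl fun i _ => ?_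
  split_ifs <;> simp

theorem evalHarmonic_Q (l n : ℕ) :
    evalHarmonic (Q l) n = PowerSeries.coeff l (completeSeries n) := by
  rw [coeff_eq_partitionSum (genHarmonic n) _ (coeff_zero_completeSeries n)
    (derivative_completeSeries n), evalHarmonic, Q, map_sum, partitionSum]
  exact Finset.sum_congr rfl fun μ _ => evalHarmonic_partitionWeight μ n

theorem evalHarmonic_P (k n : ℕ) :
    evalHarmonic (P k) n = PowerSeries.coeff k (elementarySeries n) := by
  rw [coeff_eq_partitionSum (fun i => (-1) ^ (i - 1) * genHarmonic n i) _
    (coeff_zero_elementarySeries n) (by simpa using derivative_elementarySeries n),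
    evalHarmonic, P, map_sum, partitionSum]
  refine Finset.sum_congr rfl fun μ _ => ?_
  rw [multisetWeight_sign _ fun i hi => (μ.parts_pos hi).ne', map_mul,
    ← evalHarmonic_partitionWeight, map_pow, map_neg, map_one, evalHarmonic]

end HarmonicSums

/-! ### Summation of quotients of rising factorials -/

namespace HarmonicSums

/-- The quotient `(1 + y)_n / (b)_{n + 1}` of rising factorials. -/
noncomputable def risingQuot (b y : ℝ) (n : ℕ) : ℝ :=
  (∏ j ∈ Finset.range n, (1 + y + j) / (b + j + 1)) / b

theorem risingQuot_succ (b y : ℝ) (n : ℕ) :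
    risingQuot b y (n + 1) = risingQuot b y n * ((1 + y + n) / (b + n + 1)) := by
  rw [risingQuot, risingQuot, Finset.prod_range_succ]
  ring

theorem risingQuot_nonneg {b y : ℝ} (hb : 0 < b) (hy : 0 ≤ y) (n : ℕ) :
    0 ≤ risingQuot b y n :=
  div_nonneg (Finset.prod_nonneg fun j _ => by positivity) hb.le

theorem risingQuot_le_inv {b y : ℝ} (hb : 0 < b) (hy : 0 ≤ y) (hyb : y ≤ b) (n : ℕ) :
    risingQuot b y n ≤ 1 / b := by
  refine div_le_div_of_nonneg_right ?_ hb.le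
  refine Finset.prod_le_one (fun j _ => by positivity) fun j _ => ?_
  rw [div_le_one (by positivity)]
  linarith

theorem risingQuot_anti {b b' y : ℝ} (hb : 0 < b) (hbb : b ≤ b') (hy : 0 ≤ y) (n : ℕ) :
    risingQuot b' y n ≤ risingQuot b y n := by
  have hb' : 0 < b' := hb.trans_le hbb
  unfold risingQuot
  gcongr

/-- The quotient behaves like `n^(y-b)` with `b - y ≥ 1/2`, so its square decays at least like
`1/n`. The bounds `3/4` and `1/4` fit `b = 1 - x` with `x, y < 1/4`. -/
theorem sq_risingQuot_le {b y : ℝ} (hb : 3 / 4 ≤ b) (hy : 0 ≤ y) (hy' : y ≤ 1 / 4) (n : ℕ) :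
    risingQuot b y n ^ 2 * (n + 2) ≤ risingQuot b y 0 ^ 2 * 2 := by
  induction n with
  | zero => simp
  | succ n ih =>
    refine le_trans ?_ ih
    rw [risingQuot_succ, mul_pow, mul_assoc]
    refine mul_le_mul_of_nonneg_left ?_ (sq_nonneg _)
    have hn : (0 : ℝ) ≤ n := n.cast_nonneg
    have h1 : (1 + y + n) / (b + n + 1) ≤ (n + 5 / 4) / (n + 7 / 4) := by
      apply div_le_div₀ <;> first | positivity | linarith
    have h0 : 0 ≤ (1 + y + n) / (b + n + 1) := by positivity
    calc ((1 + y + n) / (b + n + 1)) ^ 2 * (((n + 1 : ℕ) : ℝ) + 2)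
        ≤ (((n : ℝ) + 5 / 4) / (n + 7 / 4)) ^ 2 * (((n + 1 : ℕ) : ℝ) + 2) := by gcongr
      _ ≤ (n : ℝ) + 2 := by
          push_cast
          rw [div_pow, div_mul_eq_mul_div, div_le_iff₀ (by positivity)]
          nlinarith

theorem tendsto_risingQuot {b y : ℝ} (hb : 3 / 4 ≤ b) (hy : 0 ≤ y) (hy' : y ≤ 1 / 4) :
    Tendsto (risingQuot b y) atTop (𝓝 0) := by
  have hsq : Tendsto (fun n => risingQuot b y n ^ 2) atTop (𝓝 0) := by
    refine squeeze_zero (fun n => sq_nonneg _)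
      (g := fun n : ℕ => risingQuot b y 0 ^ 2 * 2 * (1 / ((n : ℝ) + 1))) (fun n => ?_) ?_
    · rw [mul_one_div, le_div_iff₀ (by positivity)]
      refine le_trans ?_ (sq_risingQuot_le hb hy hy' n)
      gcongr
      norm_num
    · simpa using (tendsto_one_div_add_atTop_nhds_zero_nat (𝕜 := ℝ)).const_mul
        (risingQuot b y 0 ^ 2 * 2)
  have := (Real.continuous_sqrt.tendsto 0).comp hsq
  rw [Real.sqrt_zero] at this
  refine this.congr fun n => ?_
  exact Real.sqrt_sq (risingQuot_nonneg (by linarith) hy n)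

/-- Telescoping: `risingQuot b y n - risingQuot b y (n + 1)` is `b - y` times the summand, and the
initial value is `1 / b`. -/
theorem hasSum_risingQuot_div {b y : ℝ} (hb : 3 / 4 ≤ b) (hy : 0 ≤ y) (hy' : y ≤ 1 / 4) :
    HasSum (fun n : ℕ => risingQuot b y n / (b + n + 1)) (1 / (b * (b - y))) := by
  have hb0 : 0 < b := by linarith
  have hby : 0 < b - y := by linarith
  rw [hasSum_iff_tendsto_nat_of_nonneg
    fun n => div_nonneg (risingQuot_nonneg hb0 hy n) (by positivity)]
  have hpart : ∀ N, ∑ n ∈ Finset.range N, risingQuot b y n / (b + n + 1) =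
      (risingQuot b y 0 - risingQuot b y N) / (b - y) := by
    intro N
    induction N with
    | zero => simp
    | succ N ih =>
      have : b + N + 1 ≠ 0 := by positivity
      rw [Finset.sum_range_succ, ih, risingQuot_succ]
      field_simp
      ring
  simp only [hpart]
  have := ((tendsto_risingQuot hb hy hy').const_sub (risingQuot b y 0)).div_const (b - y)
  convert this using 2
  simp [risingQuot]
  field_simp

theorem risingQuot_add_one {b y : ℝ} (hb : 0 < b) (n : ℕ) :
    risingQuot (b + 1) y n = risingQuot b y n * (b / (b + n + 1)) := by
  induction n with
  | zero =>
    simp [risingQuot]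
    field_simp
  | succ n ih =>
    have h1 : b + n + 1 ≠ 0 := by positivity
    have h2 : b + 1 + n + 1 ≠ 0 := by positivity
    have h3 : b + (n + 1) + 1 ≠ 0 := by positivity
    rw [risingQuot_succ, risingQuot_succ, ih]
    push_cast
    field_simp
    ring

theorem summable_risingQuot_div_succ {b y : ℝ} (hb : 3 / 4 ≤ b) (hy : 0 ≤ y) (hy' : y ≤ 1 / 4) :
    Summable fun n : ℕ => risingQuot b y n / (n + 1) := by
  have hb0 : 0 < b := by linarith
  refine Summable.of_nonneg_of_le
    (fun n => div_nonneg (risingQuot_nonneg hb0 hy n) (by positivity)) (fun n => ?_)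
    ((hasSum_risingQuot_div hb hy hy').summable.mul_left (b + 1))
  have h := risingQuot_nonneg hb0 hy n
  rw [← mul_div_assoc, div_le_div_iff₀ (by positivity) (by positivity)]
  have : b + n + 1 ≤ (b + 1) * (n + 1) := by
    nlinarith [mul_nonneg hb0.le (n.cast_nonneg : (0 : ℝ) ≤ n)]
  calc risingQuot b y n * (b + n + 1) ≤ risingQuot b y n * ((b + 1) * (n + 1)) := by gcongr
    _ = _ := by ring

/-- Raising `b` by one multiplies the quotient by `b / (b + n + 1)`; the difference has a factor `n
+ 1` that cancels the denominator and leaves the telescoping series. -/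
theorem tsum_risingQuot_sub {b y : ℝ} (hb : 3 / 4 ≤ b) (hy : 0 ≤ y) (hy' : y ≤ 1 / 4) :
    (∑' n : ℕ, risingQuot b y n / (n + 1)) - ∑' n : ℕ, risingQuot (b + 1) y n / (n + 1) =
      1 / (b * (b - y)) := by
  have hb0 : 0 < b := by linarith
  rw [← (summable_risingQuot_div_succ hb hy hy').tsum_sub
    (summable_risingQuot_div_succ (b := b + 1) (by linarith) hy hy'),
    ← (hasSum_risingQuot_div hb hy hy').tsum_eq]
  refine tsum_congr fun n => ?_
  have h1 : b + n + 1 ≠ 0 := by positivity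
  have h2 : (n : ℝ) + 1 ≠ 0 := by positivity
  rw [risingQuot_add_one hb0]
  field_simp
  ring

/-- Dominated convergence: the quotient decreases in `b`, so the terms at `M = 0` dominate, and each
term is at most `1 / (b + M)`. -/
theorem tendsto_tsum_risingQuot {b y : ℝ} (hb : 3 / 4 ≤ b) (hy : 0 ≤ y) (hy' : y ≤ 1 / 4) :
    Tendsto (fun M : ℕ => ∑' n : ℕ, risingQuot (b + M) y n / (n + 1)) atTop (𝓝 0) := by
  have hb0 : 0 < b := by linarith
  have := tendsto_tsum_of_dominated_convergence (𝓕 := atTop)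
    (f := fun (M : ℕ) (n : ℕ) => risingQuot (b + M) y n / ((n : ℝ) + 1)) (g := fun _ => (0 : ℝ))
    (summable_risingQuot_div_succ hb hy hy') (fun n => ?_) (Eventually.of_forall fun M n => ?_)
  · simpa using this
  · refine squeeze_zero
      (fun M => div_nonneg (risingQuot_nonneg (by positivity) hy n) (by positivity))
      (g := fun M : ℕ => 1 / (b + M)) (fun M => ?_) ?_
    · have hM : (0 : ℝ) ≤ M := M.cast_nonneg
      refine (div_le_self (risingQuot_nonneg (by positivity) hy n) ?_).trans
        (risingQuot_le_inv (by positivity) hy (by linarith) n)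
      simp
    · simp only [one_div]
      exact tendsto_inv_atTop_zero.comp
        (tendsto_atTop_add_const_left _ _ tendsto_natCast_atTop_atTop)
  · rw [Real.norm_of_nonneg
      (div_nonneg (risingQuot_nonneg (by positivity) hy n) (by positivity))]
    have := risingQuot_anti (b' := b + M) hb0 (by simp) hy n
    gcongr

theorem hasSum_risingQuot {b y : ℝ} (hb : 3 / 4 ≤ b) (hy : 0 ≤ y) (hy' : y ≤ 1 / 4) :
    HasSum (fun n : ℕ => risingQuot b y n / (n + 1))
      (∑' m : ℕ, 1 / ((b + m) * (b + m - y))) ∧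
    Summable fun m : ℕ => 1 / ((b + m) * (b + m - y)) := by
  have key : HasSum (fun m : ℕ => 1 / ((b + m) * (b + m - y)))
      (∑' n : ℕ, risingQuot b y n / (n + 1)) := by
    rw [hasSum_iff_tendsto_nat_of_nonneg]
    · have hpart : ∀ M : ℕ, ∑ m ∈ Finset.range M, 1 / ((b + m) * (b + m - y)) =
          (∑' n : ℕ, risingQuot b y n / (n + 1)) -
            ∑' n : ℕ, risingQuot (b + M) y n / (n + 1) := by
        intro M
        induction M with
        | zero => simp
        | succ M ih =>
          rw [Finset.sum_range_succ, ih, ← tsum_risingQuot_sub (b := b + M) _ hy hy']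
          · push_cast
            rw [add_assoc]
            ring
          · have : (0 : ℝ) ≤ M := M.cast_nonneg
            linarith
      simp only [hpart]
      simpa using (tendsto_tsum_risingQuot hb hy hy').const_sub
        (∑' n : ℕ, risingQuot b y n / (n + 1))
    · intro m
      have : (0 : ℝ) ≤ m := m.cast_nonneg
      have h1 : 0 < b + m := by linarith
      have h2 : 0 < b + m - y := by linarith
      positivity
  exact ⟨key.tsum_eq ▸ (summable_risingQuot_div_succ hb hy hy').hasSum, key.summable⟩

/-! ### Uniqueness of coefficients -/

/-- Two power series with equal sums on `(0, r)` have the same coefficients. -/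
theorem eq_of_hasSum_pow {a b : ℕ → ℝ} {r : ℝ} (hr : 0 < r)
    (h : ∀ x ∈ Set.Ioo 0 r, ∃ s, HasSum (fun n => a n * x ^ n) s ∧
      HasSum (fun n => b n * x ^ n) s) : a = b := by
  suffices H : ∀ n, a n - b n = 0 from funext fun n => sub_eq_zero.1 (H n)
  set d : ℕ → ℝ := fun n => a n - b n with hd
  have hsum : ∀ x ∈ Set.Ioo 0 r, HasSum (fun n => d n * x ^ n) 0 := by
    intro x hx
    obtain ⟨s, ha, hb⟩ := h x hx
    simpa [hd, sub_mul] using ha.sub hb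
  intro n
  change d n = 0
  induction n using Nat.strong_induction_on with
  | _ n ih =>
    -- The coefficients below `n` vanish, so the series may be divided by `x^n`; letting `x → 0+`
    -- then isolates `d n`.
    have hshift : ∀ x ∈ Set.Ioo 0 r, HasSum (fun m => d (m + n) * x ^ m) 0 := by
      intro x hx
      have h1 := (hasSum_nat_add_iff' n).2 (hsum x hx)
      rw [Finset.sum_eq_zero fun i hi => by rw [ih i (Finset.mem_range.1 hi), zero_mul],
        sub_zero] at h1
      have hx0 : x ^ n ≠ 0 := (pow_pos hx.1 n).ne'
      have h2 := h1.mul_left (x ^ n)⁻¹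
      rw [mul_zero] at h2
      refine h2.congr_fun fun m => ?_
      rw [pow_add]
      field_simp
    have hr2 : r / 2 ∈ Set.Ioo 0 r := ⟨by linarith, by linarith⟩
    have hcont : ContinuousOn (fun x : ℝ => ∑' m, d (m + n) * x ^ m) (Set.Icc 0 (r / 2)) := by
      refine continuousOn_tsum (u := fun m => ‖d (m + n) * (r / 2) ^ m‖)
        (fun m => by fun_prop) (hshift _ hr2).summable.norm fun m x hx => ?_
      rw [norm_mul, norm_mul, norm_pow, norm_pow, Real.norm_of_nonneg hx.1,
        Real.norm_of_nonneg hr2.1.le]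
      have := hx.1
      have := hx.2
      gcongr
    have h0 : (∑' m, d (m + n) * (0 : ℝ) ^ m) = d n := by
      rw [tsum_eq_single 0 fun m hm => by simp [hm]]
      simp
    have hlim : Tendsto (fun x : ℝ => ∑' m, d (m + n) * x ^ m) (𝓝[>] 0) (𝓝 (d n)) := by
      rw [← h0]
      exact (hcont 0 ⟨le_rfl, hr2.1.le⟩).mono_left
        (nhdsWithin_le_of_mem (Icc_mem_nhdsGT hr2.1))
    have hzero : Tendsto (fun x : ℝ => ∑' m, d (m + n) * x ^ m) (𝓝[>] 0) (𝓝 0) := by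
      refine (tendsto_congr' ?_).2 tendsto_const_nhds
      filter_upwards [Ioo_mem_nhdsGT hr] with x hx using (hshift x hx).tsum_eq
    exact tendsto_nhds_unique hlim hzero

/-- Two double power series with equal sums on `(0, r) × (0, r)` have the same coefficients. -/
theorem eq_of_hasSum_pow_mul_pow {a b : ℕ → ℕ → ℝ} {r : ℝ} (hr : 0 < r)
    (h : ∀ x ∈ Set.Ioo 0 r, ∀ y ∈ Set.Ioo 0 r, ∃ s,
      HasSum (fun p : ℕ × ℕ => a p.1 p.2 * x ^ p.1 * y ^ p.2) s ∧
      HasSum (fun p : ℕ × ℕ => b p.1 p.2 * x ^ p.1 * y ^ p.2) s) : a = b := by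
  have hr2 : r / 2 ∈ Set.Ioo 0 r := ⟨by linarith, by linarith⟩
  have hfib : ∀ c : ℕ → ℕ → ℝ, ∀ x ∈ Set.Ioo 0 r, ∀ y ∈ Set.Ioo 0 r, ∀ s,
      HasSum (fun p : ℕ × ℕ => c p.1 p.2 * x ^ p.1 * y ^ p.2) s → ∀ l,
      HasSum (fun k => c l k * x ^ l * y ^ k) ((∑' k, c l k * y ^ k) * x ^ l) := by
    intro c x hx y hy s hs l
    have h1 := hs.summable.prod_factor l
    have hx0 : x ^ l ≠ 0 := (pow_pos hx.1 l).ne'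
    have h2 : Summable fun k => c l k * y ^ k := by
      refine (h1.mul_left (x ^ l)⁻¹).congr fun k => ?_
      field_simp
    refine (h2.hasSum.mul_right (x ^ l)).congr_fun fun k => ?_
    ring
  -- For fixed `y` the row sums are the coefficients of a power series in `x`, so one-variable
  -- uniqueness applies first in `x`, then in `y`.
  have hrow : ∀ y ∈ Set.Ioo 0 r, (fun l => ∑' k, a l k * y ^ k) = fun l => ∑' k, b l k * y ^ k := by
    intro y hy
    refine eq_of_hasSum_pow hr fun x hx => ?_
    obtain ⟨s, ha, hb⟩ := h x hx y hy
    exact ⟨s, ha.prod_fiberwise (hfib a x hx y hy s ha), hb.prod_fiberwise (hfib b x hx y hy s hb)⟩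
  have hsummable : ∀ c : ℕ → ℕ → ℝ, (∀ y ∈ Set.Ioo 0 r, ∃ s,
      HasSum (fun p : ℕ × ℕ => c p.1 p.2 * (r / 2) ^ p.1 * y ^ p.2) s) →
      ∀ l, ∀ y ∈ Set.Ioo 0 r, Summable fun k => c l k * y ^ k := by
    intro c hc l y hy
    obtain ⟨s, hs⟩ := hc y hy
    have hx0 : (r / 2) ^ l ≠ 0 := (pow_pos hr2.1 l).ne'
    refine ((hs.summable.prod_factor l).mul_left ((r / 2) ^ l)⁻¹).congr fun k => ?_
    field_simp
  funext l
  refine eq_of_hasSum_pow hr fun y hy => ⟨∑' k, a l k * y ^ k, ?_, ?_⟩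
  · exact (hsummable a (fun y hy => (h _ hr2 y hy).imp fun _ => And.left) l y hy).hasSum
  · rw [congrFun (hrow y hy) l]
    exact (hsummable b (fun y hy => (h _ hr2 y hy).imp fun _ => And.right) l y hy).hasSum

end HarmonicSums

/-! ### Expansion in two variables and comparison of coefficients -/

namespace HarmonicSums

theorem hasSum_coeff_mul {A B : PowerSeries ℝ} {x a b : ℝ}
    (hA : HasSum (fun n => PowerSeries.coeff n A * x ^ n) a)
    (hB : HasSum (fun n => PowerSeries.coeff n B * x ^ n) b) :
    HasSum (fun n => PowerSeries.coeff n (A * B) * x ^ n) (a * b) := by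
  have h := summable_norm_sum_mul_antidiagonal_of_summable_norm hA.summable.norm hB.summable.norm
  have h2 := tsum_mul_tsum_eq_tsum_sum_antidiagonal_of_summable_norm
    hA.summable.norm hB.summable.norm
  rw [hA.tsum_eq, hB.tsum_eq] at h2
  rw [h2]
  refine h.of_norm.hasSum.congr_fun fun n => ?_
  rw [PowerSeries.coeff_mul, Finset.sum_mul]
  refine Finset.sum_congr rfl fun p hp => ?_
  rw [← Finset.HasAntidiagonal.mem_antidiagonal.1 hp, pow_add]
  ring

theorem hasSum_completeSeries {x : ℝ} (hx : 0 ≤ x) (hx' : x < 1) (n : ℕ) :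
    HasSum (fun l => PowerSeries.coeff l (completeSeries n) * x ^ l)
      (∏ j ∈ Finset.range n, (1 - 1 / ((j : ℝ) + 1) * x)⁻¹) := by
  induction n with
  | zero =>
    rw [Finset.prod_range_zero]
    refine (hasSum_ite_eq (0 : ℕ) (1 : ℝ)).congr_fun fun l => ?_
    rcases l with _ | l <;> simp [completeSeries, PowerSeries.coeff_one]
  | succ n ih =>
    rw [completeSeries, Finset.prod_range_succ, Finset.prod_range_succ, ← completeSeries]
    refine hasSum_coeff_mul ih ?_
    simp only [PowerSeries.coeff_mk, ← mul_pow]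
    refine hasSum_geometric_of_lt_one (by positivity) ?_
    rw [one_div_mul_eq_div, div_lt_one (by positivity)]
    have : (0 : ℝ) ≤ n := n.cast_nonneg
    linarith

theorem hasSum_elementarySeries (y : ℝ) (n : ℕ) :
    HasSum (fun k => PowerSeries.coeff k (elementarySeries n) * y ^ k)
      (∏ j ∈ Finset.range n, (1 + 1 / ((j : ℝ) + 1) * y)) := by
  induction n with
  | zero =>
    rw [Finset.prod_range_zero]
    refine (hasSum_ite_eq (0 : ℕ) (1 : ℝ)).congr_fun fun l => ?_
    rcases l with _ | l <;> simp [elementarySeries, PowerSeries.coeff_one]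
  | succ n ih =>
    rw [elementarySeries, Finset.prod_range_succ, Finset.prod_range_succ, ← elementarySeries]
    refine hasSum_coeff_mul ih ?_
    have hzero : ∀ k ∉ Finset.range 2, PowerSeries.coeff k
        (1 + PowerSeries.C (1 / ((n : ℝ) + 1)) * PowerSeries.X) * y ^ k = 0 := by
      intro k hk
      have h0 : k ≠ 0 := by rintro rfl; simp at hk
      have h1 : k ≠ 1 := by rintro rfl; simp at hk
      simp [PowerSeries.coeff_one, PowerSeries.coeff_X, h0, h1]
    have h : HasSum _ _ := hasSum_sum_of_ne_finset_zero hzero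
    simpa [Finset.sum_range_succ, PowerSeries.coeff_one, PowerSeries.coeff_X] using h

theorem coeff_completeSeries_nonneg (l n : ℕ) :
    0 ≤ PowerSeries.coeff l (completeSeries n) := by
  induction n generalizing l with
  | zero => rw [completeSeries, Finset.prod_range_zero, PowerSeries.coeff_one]; positivity
  | succ n ih =>
    rw [completeSeries, Finset.prod_range_succ, ← completeSeries, PowerSeries.coeff_mul]
    refine Finset.sum_nonneg fun p _ => mul_nonneg (ih _) ?_
    rw [PowerSeries.coeff_mk]
    positivity

theorem coeff_elementarySeries_nonneg (k n : ℕ) :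
    0 ≤ PowerSeries.coeff k (elementarySeries n) := by
  induction n generalizing k with
  | zero => rw [elementarySeries, Finset.prod_range_zero, PowerSeries.coeff_one]; positivity
  | succ n ih =>
    rw [elementarySeries, Finset.prod_range_succ, ← elementarySeries, PowerSeries.coeff_mul]
    refine Finset.sum_nonneg fun p _ => mul_nonneg (ih _) ?_
    rw [map_add, PowerSeries.coeff_one, PowerSeries.coeff_C_mul, PowerSeries.coeff_X]
    positivity

theorem prod_mul_prod_eq_risingQuot {x : ℝ} (hx : x < 1) (y : ℝ) (n : ℕ) :
    (∏ j ∈ Finset.range (n + 1), (1 - 1 / ((j : ℝ) + 1) * x)⁻¹) *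
        (∏ j ∈ Finset.range n, (1 + 1 / ((j : ℝ) + 1) * y)) / ((n : ℝ) + 1) ^ 2 =
      risingQuot (1 - x) y n / (n + 1) := by
  have key : (∏ j ∈ Finset.range (n + 1), (1 - 1 / ((j : ℝ) + 1) * x)⁻¹) *
      (∏ j ∈ Finset.range n, (1 + 1 / ((j : ℝ) + 1) * y)) = risingQuot (1 - x) y n * (n + 1) := by
    induction n with
    | zero => simp [risingQuot]
    | succ n ih =>
      have hn : (0 : ℝ) ≤ n := n.cast_nonneg
      have h1 : (n : ℝ) + 1 ≠ 0 := by positivity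
      have h2 : (n : ℝ) + 1 + 1 ≠ 0 := by positivity
      have h3 : (n : ℝ) + 1 + 1 - x ≠ 0 := by linarith
      have h4 : 1 - x + n + 1 ≠ 0 := by linarith
      have h5 : (1 - 1 / ((n : ℝ) + 1 + 1) * x)⁻¹ = (n + 1 + 1) / (1 - x + n + 1) := by
        rw [show 1 - 1 / ((n : ℝ) + 1 + 1) * x = (1 - x + n + 1) / (n + 1 + 1) by
          field_simp; ring, inv_div]
      rw [Finset.prod_range_succ _ (n + 1),
        Finset.prod_range_succ (fun j : ℕ => 1 + 1 / ((j : ℝ) + 1) * y) n, mul_mul_mul_comm, ih,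
        risingQuot_succ]
      push_cast
      rw [h5]
      field_simp
      ring
  rw [key]
  have h1 : (n : ℝ) + 1 ≠ 0 := by positivity
  field_simp

/-- Interchange of summation for a family of power series with nonnegative coefficients. -/
theorem hasSum_tsum_mul_pow {c : ℕ → ℕ → ℕ → ℝ} (hc : ∀ n l k, 0 ≤ c n l k) {x y : ℝ}
    (hx : 0 < x) (hy : 0 < y) {t : ℕ → ℝ} {s : ℝ}
    (h : ∀ n, HasSum (fun p : ℕ × ℕ => c n p.1 p.2 * x ^ p.1 * y ^ p.2) (t n))
    (ht : HasSum t s) :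
    (∀ l k, Summable fun n => c n l k) ∧
    HasSum (fun p : ℕ × ℕ => (∑' n, c n p.1 p.2) * x ^ p.1 * y ^ p.2) s := by
  -- Nonnegativity makes the triple family summable as soon as its iterated sums converge.
  have hs : Summable fun q : ℕ × (ℕ × ℕ) => c q.1 q.2.1 q.2.2 * x ^ q.2.1 * y ^ q.2.2 := by
    rw [summable_prod_of_nonneg]
    · refine ⟨fun n => (h n).summable, ?_⟩
      simpa only [(h _).tsum_eq] using ht.summable
    · intro q
      have := hc q.1 q.2.1 q.2.2
      simp only [Pi.zero_apply]
      positivity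
  have hsum : ∀ l k, Summable fun n => c n l k := by
    intro l k
    have h1 := hs.prod_symm.prod_factor (l, k)
    have h2 : x ^ l * y ^ k ≠ 0 := by positivity
    refine (h1.mul_right (x ^ l * y ^ k)⁻¹).congr fun n => ?_
    simp only [Prod.swap_prod_mk]
    field_simp
  refine ⟨hsum, ?_⟩
  have h3 := hs.hasSum.prod_fiberwise h
  rw [← h3.unique ht] at *
  have h4 := ((Equiv.prodComm _ _).hasSum_iff.2 hs.hasSum).prod_fiberwise
    (g := fun p : ℕ × ℕ => (∑' n, c n p.1 p.2) * x ^ p.1 * y ^ p.2) fun p => by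
      simpa [mul_assoc] using (hsum p.1 p.2).hasSum.mul_right (x ^ p.1 * y ^ p.2)
  exact h4

/-- With `M = m + 1`, the term `1 / ((M-x)(M-x-y))` is a geometric series in `y / (M-x)`, and each
`(M-x)^(-k-2)` is a negative binomial series in `x / M`. -/
theorem hasSum_choose_div_pow {x y : ℝ} (hx : 0 < x) (hy : 0 < y) (hxy : x + y < 1) (m : ℕ) :
    HasSum (fun p : ℕ × ℕ => ((p.1 + p.2 + 1).choose p.1 : ℝ) / ((m : ℝ) + 1) ^ (p.1 + p.2 + 2) *
      x ^ p.1 * y ^ p.2) (1 / ((1 - x + m) * (1 - x + m - y))) := by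
  have hm : (0 : ℝ) ≤ m := m.cast_nonneg
  set M : ℝ := m + 1 with hM
  have hM0 : 0 < M := by positivity
  have hxM : 0 < M - x := by linarith
  have hxyM : 0 < M - x - y := by linarith
  have hin : ∀ k : ℕ, HasSum (fun l : ℕ => ((l + k + 1).choose l : ℝ) / M ^ (l + k + 2) *
      x ^ l * y ^ k) (y ^ k / (M - x) ^ (k + 2)) := by
    intro k
    have hu : ‖x / M‖ < 1 := by
      rw [Real.norm_of_nonneg (by positivity), div_lt_one hM0]; linarith
    have h1 := (hasSum_choose_mul_geometric_of_norm_lt_one (k + 1) hu).mul_right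
      (y ^ k / M ^ (k + 2))
    have h2 : y ^ k / (M - x) ^ (k + 2) =
        1 / (1 - x / M) ^ (k + 1 + 1) * (y ^ k / M ^ (k + 2)) := by
      rw [one_sub_div hM0.ne', div_pow]
      field_simp
    rw [h2]
    refine h1.congr_fun fun l => ?_
    rw [add_assoc l k 1, Nat.choose_symm_of_eq_add (show l + (k + 1) = l + (k + 1) from rfl), div_pow,
      add_assoc l k 2, pow_add M l]
    field_simp
  have hout : HasSum (fun k : ℕ => y ^ k / (M - x) ^ (k + 2)) (1 / ((M - x) * (M - x - y))) := by
    have h1 := (hasSum_geometric_of_lt_one (r := y / (M - x)) (by positivity)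
      ((div_lt_one hxM).2 (by linarith))).mul_right (1 / (M - x) ^ 2)
    have h2 : 1 / ((M - x) * (M - x - y)) = (1 - y / (M - x))⁻¹ * (1 / (M - x) ^ 2) := by
      rw [one_sub_div hxM.ne']
      field_simp
    rw [h2]
    refine h1.congr_fun fun k => ?_
    rw [div_pow, pow_add]
    field_simp
  have hs : Summable fun q : ℕ × ℕ => ((q.2 + q.1 + 1).choose q.2 : ℝ) / M ^ (q.2 + q.1 + 2) *
      x ^ q.2 * y ^ q.1 := by
    rw [summable_prod_of_nonneg]
    · refine ⟨fun k => (hin k).summable, ?_⟩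
      simpa only [(hin _).tsum_eq] using hout.summable
    · intro q
      simp only [Pi.zero_apply]
      positivity
  have h3 := hs.hasSum.prod_fiberwise hin
  have h4 := hs.hasSum
  rw [h3.unique hout] at h4
  rw [show 1 - x + (m : ℝ) = M - x by rw [hM]; ring]
  exact (Equiv.prodComm _ _).hasSum_iff.2 h4

theorem hasSum_complete_mul_elementary (l k : ℕ) :
    HasSum (fun n : ℕ => PowerSeries.coeff l (completeSeries (n + 1)) *
        PowerSeries.coeff k (elementarySeries n) / ((n : ℝ) + 1) ^ 2)
      (((l + k + 1).choose l : ℝ) * ∑' m : ℕ, 1 / ((m : ℝ) + 1) ^ (l + k + 2)) := by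
  set c : ℕ → ℕ → ℕ → ℝ := fun n l k => PowerSeries.coeff l (completeSeries (n + 1)) *
    PowerSeries.coeff k (elementarySeries n) / ((n : ℝ) + 1) ^ 2 with hc
  set d : ℕ → ℕ → ℕ → ℝ := fun m l k =>
    ((l + k + 1).choose l : ℝ) / ((m : ℝ) + 1) ^ (l + k + 2) with hd
  have hc0 : ∀ n l k, 0 ≤ c n l k := fun n l k =>
    div_nonneg (mul_nonneg (coeff_completeSeries_nonneg _ _) (coeff_elementarySeries_nonneg _ _))
      (by positivity)
  have hd0 : ∀ n l k, 0 ≤ d n l k := fun n l k => by positivity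
  have hC : ∀ x ∈ Set.Ioo (0 : ℝ) (1 / 4), ∀ y ∈ Set.Ioo (0 : ℝ) (1 / 4),
      (∀ l k, Summable fun n => c n l k) ∧
      HasSum (fun p : ℕ × ℕ => (∑' n, c n p.1 p.2) * x ^ p.1 * y ^ p.2)
        (∑' m : ℕ, 1 / ((1 - x + m) * (1 - x + m - y))) := by
    intro x hx y hy
    refine hasSum_tsum_mul_pow hc0 hx.1 hy.1 (fun n => ?_)
      (hasSum_risingQuot (by linarith [hx.2]) hy.1.le hy.2.le).1
    rw [← prod_mul_prod_eq_risingQuot (by linarith [hx.2])]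
    have hA := hasSum_completeSeries hx.1.le (by linarith [hx.2]) (n + 1)
    have hB := hasSum_elementarySeries y n
    refine ((hA.mul hB (summable_mul_of_summable_norm hA.summable.norm
      hB.summable.norm)).div_const (((n : ℝ) + 1) ^ 2)).congr_fun fun p => ?_
    simp only [hc]
    ring
  have hD : ∀ x ∈ Set.Ioo (0 : ℝ) (1 / 4), ∀ y ∈ Set.Ioo (0 : ℝ) (1 / 4),
      HasSum (fun p : ℕ × ℕ => (∑' n, d n p.1 p.2) * x ^ p.1 * y ^ p.2)
        (∑' m : ℕ, 1 / ((1 - x + m) * (1 - x + m - y))) := fun x hx y hy =>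
    (hasSum_tsum_mul_pow hd0 hx.1 hy.1
      (fun m => hasSum_choose_div_pow hx.1 hy.1 (by linarith [hx.2, hy.2]) m)
      (hasSum_risingQuot (by linarith [hx.2]) hy.1.le hy.2.le).2.hasSum).2
  have heq : (fun l k => ∑' n, c n l k) = fun l k => ∑' n, d n l k :=
    eq_of_hasSum_pow_mul_pow (r := 1 / 4) (by norm_num) fun x hx y hy =>
      ⟨_, (hC x hx y hy).2, hD x hx y hy⟩
  -- Summability over `n` for fixed `l, k` does not involve `x, y`, so any point of the square
  -- serves.
  have h8 : (1 / 8 : ℝ) ∈ Set.Ioo (0 : ℝ) (1 / 4) := by constructor <;> norm_num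
  have h := ((hC _ h8 _ h8).1 l k).hasSum
  rw [congrFun (congrFun heq l) k] at h
  convert h using 1
  rw [← tsum_mul_left]
  simp only [hd, mul_one_div]

end HarmonicSums

theorem theorem4 (k l : ℕ) :
    HasSum
      (fun n : ℕ =>
        ((HarmonicSums.evalHarmonic (HarmonicSums.Q l) (n + 1) *
            HarmonicSums.evalHarmonic (HarmonicSums.P k) n / ((n : ℝ) + 1) ^ 2 : ℝ) : ℂ))
      (((l + k + 1).choose l : ℂ) * riemannZeta ((l : ℂ) + (k : ℂ) + 2)) := by
  simp only [HarmonicSums.evalHarmonic_Q, HarmonicSums.evalHarmonic_P]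
  have hz : riemannZeta ((l : ℂ) + (k : ℂ) + 2) =
      ((∑' m : ℕ, 1 / ((m : ℝ) + 1) ^ (l + k + 2) : ℝ) : ℂ) := by
    have h1 := zeta_eq_tsum_one_div_nat_add_one_cpow (s := ((l + k + 2 : ℕ) : ℂ))
      (by rw [Complex.natCast_re]; push_cast; linarith [l.cast_nonneg (α := ℝ), k.cast_nonneg (α := ℝ)])
    simp only [Complex.cpow_natCast] at h1
    push_cast at h1 ⊢
    exact h1
  rw [hz]
  exact_mod_cast Complex.hasSum_ofReal.2 (HarmonicSums.hasSum_complete_mul_elementary l k)
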